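/- Let $\Omega\subset\mathbb{R}^3$ be a bounded, contractible Lipschitz domain with outward unit normal $\bm n$, and let $(\cdot,\cdot)$ and $\|\cdot\|$ be the inner product and norm of $L^2(\Omega)$. Let $H^1_0$, $H_0(\operatorname{curl})$, $H_0(\operatorname{div})$ be the spaces of $L^2$ fields with $L^2$ weak gradient, curl, divergence and with boundary conditions $v=0$, $\bm v\times\bm n=\bm 0$, $\bm v\cdot\bm n=0$ on $\partial\Omega$ respectively, and let $L^2_0=\{q\in L^2(\Omega):\int_\Omega q=0\}$. There is a constant $C>0$, depending only on $\Omega$, such that the following holds. Let $$0\to H_0^{1,h}\xrightarrow{\operatorname{grad}}H_0^h(\operatorname{curl})\xrightarrow{\operatorname{curl}}H_0^h(\operatorname{div})\xrightarrow{\operatorname{div}}L_0^{2,h}\to 0$$ be a finite-dimensional (finite element) subcomplex of the de Rham complex $0\to H_0^1\to H_0(\operatorname{curl})\to H_0(\operatorname{div})\to L_0^2\to 0$ which is exact. Let $\tau>0$, let $\bm B_0\in H_0^h(\operatorname{div})$ with $\operatorname{div}\bm B_0=0$, and let $\bm B_h\in C^1([0,\infty);H_0^h(\operatorname{div}))$ and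 $\bm E_h,\bm j_h,\bm H_h\in C^0([0,\infty);H_0^h(\operatorname{curl}))$ satisfy $\bm B_h(0)=\bm B_0$ and, for all $t\ge 0$ and all $(\bm C_h,\bm F_h,\bm K_h,\bm D_h)\in H_0^h(\operatorname{div})\times H_0^h(\operatorname{curl})^3$, $$\begin{aligned} (\partial_t\bm B_h,\bm C_h)+(\operatorname{curl}\bm E_h,\bm C_h)&=0,\\ (\bm E_h,\bm F_h)+\tau\,((\bm j_h\times\bm H_h)\times\bm H_h,\bm F_h)&=0,\\ (\bm j_h,\bm K_h)&=(\bm B_h,\operatorname{curl}\bm K_h),\\ (\bm H_h,\bm D_h)&=(\bm B_h,\bm D_h), \end{aligned}$$ where the integrals in the second equation converge (as they always do for piecewise polynomial fields). Then for every $t\ge 0$ there is $\bm A_h\in H_0^h(\operatorname{curl})$ with $\operatorname{curl}\bm A_h=\bm B_h(t)$, and the discrete helicity $\mathcal H_h:=(\bm A_h,\bm B_h(t))$ depends neither on the choice of $\bm A_h$ nor on $t$. The discrete energy $\mathcal E_h(t):=\|\bm B_h(t)\|^2$ stays in a fixed bounded interval: $$C\,|\mathcal H_h|\le\mathcal E_h(t)\le\mathcal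 E_h(0)\qquad\text{for all }t\ge 0 .$$ -/

import Mathlib

open MeasureTheory Set
open scoped ContDiff

noncomputable section

/-- Three-dimensional Euclidean space. -/
abbrev E3 : Type := EuclideanSpace ℝ (Fin 3)

/-- A bounded Lipschitz domain in `ℝ³`: a bounded connected open set which, near each of its
boundary points and in suitable Cartesian coordinates, is the set of points lying above the graph
of a Lipschitz function of two variables. -/
structure IsBoundedLipschitzDomain (Ω : Set E3) : Prop where
  isOpen : IsOpen Ω
  isConnected : IsConnected Ω
  isBounded : Bornology.IsBounded Ω
  lipschitz_boundary : ∀ p ∈ frontier Ω,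
    ∃ (e : E3 ≃ₗᵢ[ℝ] E3) (g : EuclideanSpace ℝ (Fin 2) → ℝ) (K : NNReal) (U : Set E3),
      LipschitzWith K g ∧ IsOpen U ∧ p ∈ U ∧
        ∀ y ∈ U, (y ∈ Ω ↔ g !₂[e y 0, e y 1] < e y 2)

/-! ### Classical vector calculus in `ℝ³` (applied to smooth test functions only) -/

/-- The partial derivative `∂ᵢ ψₖ` of the `k`-th component of a vector field. -/
def pderiv (i k : Fin 3) (ψ : E3 → E3) (x : E3) : ℝ :=
  (fderiv ℝ ψ x (EuclideanSpace.single i 1)) k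

/-- The classical curl. -/
def classicalCurl (ψ : E3 → E3) (x : E3) : E3 :=
  !₂[pderiv 1 2 ψ x - pderiv 2 1 ψ x,
     pderiv 2 0 ψ x - pderiv 0 2 ψ x,
     pderiv 0 1 ψ x - pderiv 1 0 ψ x]

/-- The classical divergence. -/
def classicalDiv (ψ : E3 → E3) (x : E3) : ℝ :=
  ∑ i, pderiv i i ψ x

/-- The vector product in `ℝ³`. -/
def cross (a b : E3) : E3 :=
  WithLp.toLp 2 (crossProduct (WithLp.ofLp a) (WithLp.ofLp b))

/-! ### The Hilbert spaces -/

/-- Scalar-valued `L²(Ω)`. -/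
abbrev L2S (Ω : Set E3) : Type := Lp ℝ 2 (volume.restrict Ω)

/-- Vector-valued `L²(Ω)`. -/
abbrev L2V (Ω : Set E3) : Type := Lp E3 2 (volume.restrict Ω)

/-- `g` is the weak gradient of `u` in `Ω`. -/
def IsWeakGrad (Ω : Set E3) (u : L2S Ω) (g : L2V Ω) : Prop :=
  ∀ ψ : E3 → E3, ContDiff ℝ ∞ ψ → HasCompactSupport ψ → tsupport ψ ⊆ Ω →
    ∫ x in Ω, inner ℝ (g x) (ψ x) = - ∫ x in Ω, u x * classicalDiv ψ x

/-- `w` is the weak curl of `v` in `Ω`. -/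
def IsWeakCurl (Ω : Set E3) (v w : L2V Ω) : Prop :=
  ∀ ψ : E3 → E3, ContDiff ℝ ∞ ψ → HasCompactSupport ψ → tsupport ψ ⊆ Ω →
    ∫ x in Ω, inner ℝ (w x) (ψ x) = ∫ x in Ω, inner ℝ (v x) (classicalCurl ψ x)

/-- `d` is the weak divergence of `v` in `Ω`. -/
def IsWeakDiv (Ω : Set E3) (v : L2V Ω) (d : L2S Ω) : Prop :=
  ∀ φ : E3 → ℝ, ContDiff ℝ ∞ φ → HasCompactSupport φ → tsupport φ ⊆ Ω →
    ∫ x in Ω, d x * φ x = - ∫ x in Ω, inner ℝ (v x) (gradient φ x)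

/-- `u ∈ H¹₀(Ω)` and `grad u = g`. The boundary condition `u = 0` on `∂Ω` is expressed, as usual
for traces, by the vanishing of the boundary term
`∫_∂Ω u ψ·n = ∫_Ω (grad u)·ψ + ∫_Ω u div ψ` of Green's formula, for all `ψ` smooth up to `∂Ω`. -/
def HasGrad0 (Ω : Set E3) (u : L2S Ω) (g : L2V Ω) : Prop :=
  IsWeakGrad Ω u g ∧ ∀ ψ : E3 → E3, ContDiff ℝ ∞ ψ →
    (∫ x in Ω, inner ℝ (g x) (ψ x)) + ∫ x in Ω, u x * classicalDiv ψ x = 0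

/-- `v ∈ H₀(curl)` and `curl v = w`. The boundary condition `v × n = 0` on `∂Ω` is expressed by the
vanishing of the boundary term
`-∫_∂Ω (v × n)·ψ = ∫_Ω (curl v)·ψ - ∫_Ω v·curl ψ`
of Green's formula (this is how the tangential trace on `H(curl)` is defined), for all `ψ` smooth
up to `∂Ω`. -/
def HasCurl0 (Ω : Set E3) (v w : L2V Ω) : Prop :=
  IsWeakCurl Ω v w ∧ ∀ ψ : E3 → E3, ContDiff ℝ ∞ ψ →
    (∫ x in Ω, inner ℝ (w x) (ψ x)) - ∫ x in Ω, inner ℝ (v x) (classicalCurl ψ x) = 0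

/-- `v ∈ H₀(div)` and `div v = d`. The boundary condition `v · n = 0` on `∂Ω` is expressed by the
vanishing of the boundary term
`∫_∂Ω (v·n) φ = ∫_Ω (div v) φ + ∫_Ω v·grad φ`
of Green's formula (this is how the normal trace on `H(div)` is defined), for all `φ` smooth up to
`∂Ω`. -/
def HasDiv0 (Ω : Set E3) (v : L2V Ω) (d : L2S Ω) : Prop :=
  IsWeakDiv Ω v d ∧ ∀ φ : E3 → ℝ, ContDiff ℝ ∞ φ →
    (∫ x in Ω, d x * φ x) + ∫ x in Ω, inner ℝ (v x) (gradient φ x) = 0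

/-- The weak curl is unique, so "`HasCurl0 Ω v w`" does say "`w` is *the* curl of `v`". -/
theorem HasCurl0.unique {Ω : Set E3} (hΩ : IsOpen Ω) {v w w' : L2V Ω}
    (h : HasCurl0 Ω v w) (h' : HasCurl0 Ω v w') : w = w' := by
  have key : ∀ᵐ x ∂(volume.restrict Ω), x ∈ Ω → (w - w' : L2V Ω) x = 0 := by
    refine hΩ.ae_eq_zero_of_integral_contDiff_smul_eq_zero
      (((Lp.memLp (w - w')).locallyIntegrable (by norm_num)).locallyIntegrableOn Ω) ?_
    intro φ hφ hc hs
    refine ext_inner_right ℝ fun c => ?_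
    have hψ : ContDiff ℝ ∞ (fun x => φ x • c) := hφ.smul contDiff_const
    have hψc : HasCompactSupport (fun x => φ x • c) := hc.smul_right
    have hψs : tsupport (fun x => φ x • c) ⊆ Ω :=
      (closure_mono (Function.support_smul_subset_left φ (fun _ => c))).trans hs
    have e := (h.1 _ hψ hψc hψs).trans (h'.1 _ hψ hψc hψs).symm
    have hm : MemLp (fun x => φ x • c) 2 (volume.restrict Ω) :=
      hψ.continuous.memLp_of_hasCompactSupport hψc
    have hL : ∀ z : L2V Ω, ∫ x in Ω, inner ℝ (z x) (φ x • c) = inner ℝ z (hm.toLp _) := by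
      intro z
      rw [L2.inner_def]
      refine integral_congr_ae ?_
      filter_upwards [hm.coeFn_toLp] with x hx
      rw [hx]
    have hz : inner ℝ (w - w') (hm.toLp _) = 0 := by
      rw [inner_sub_left, ← hL, ← hL, e, sub_self]
    rw [← hL] at hz
    have hint : Integrable (fun x => φ x • (w - w' : L2V Ω) x) (volume.restrict Ω) := by
      have h1 : MemLp φ 2 (volume.restrict Ω) := hφ.continuous.memLp_of_hasCompactSupport hc
      exact memLp_one_iff_integrable.1 ((Lp.memLp (w - w')).smul h1)
    rw [inner_zero_left, real_inner_comm, ← integral_inner hint, ← hz]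
    refine integral_congr_ae (Filter.Eventually.of_forall fun x => ?_)
    simp only [inner_smul_right, real_inner_comm]
  have key' : ∀ᵐ x ∂(volume.restrict Ω), (w - w' : L2V Ω) x = 0 := by
    filter_upwards [key, ae_restrict_mem hΩ.measurableSet] with x h1 h2 using h1 h2
  exact sub_eq_zero.1 ((Lp.eq_zero_iff_ae_eq_zero).2 key')

/-! ### The discrete complex and the scheme -/

/-- A finite-dimensional subcomplex
`0 → H¹₀ʰ → H₀ʰ(curl) → H₀ʰ(div) → L²₀ʰ → 0` (maps `grad`, `curl`, `div`)
of the de Rham complex with homogeneous boundary conditions, which is exact. -/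
structure DiscreteComplex (Ω : Set E3) where
  /-- the space `H¹₀ʰ` -/
  VGrad : Submodule ℝ (L2S Ω)
  /-- the space `H₀ʰ(curl)` -/
  VCurl : Submodule ℝ (L2V Ω)
  /-- the space `H₀ʰ(div)` -/
  VDiv : Submodule ℝ (L2V Ω)
  /-- the space `L²₀ʰ` -/
  VL2 : Submodule ℝ (L2S Ω)
  finite_VGrad : FiniteDimensional ℝ VGrad
  finite_VCurl : FiniteDimensional ℝ VCurl
  finite_VDiv : FiniteDimensional ℝ VDiv
  finite_VL2 : FiniteDimensional ℝ VL2
  grad_mem : ∀ u ∈ VGrad, ∃ g ∈ VCurl, HasGrad0 Ω u g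
  curl_mem : ∀ v ∈ VCurl, ∃ w ∈ VDiv, HasCurl0 Ω v w
  div_mem : ∀ v ∈ VDiv, ∃ d ∈ VL2, HasDiv0 Ω v d
  mean_zero : ∀ q ∈ VL2, ∫ x in Ω, q x = 0
  exact_VGrad : ∀ u ∈ VGrad, HasGrad0 Ω u 0 → u = 0
  exact_VCurl : ∀ v ∈ VCurl, HasCurl0 Ω v 0 → ∃ u ∈ VGrad, HasGrad0 Ω u v
  exact_VDiv : ∀ w ∈ VDiv, HasDiv0 Ω w 0 → ∃ v ∈ VCurl, HasCurl0 Ω v w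
  exact_VL2 : ∀ q ∈ VL2, ∃ w ∈ VDiv, HasDiv0 Ω w q

/-- `(B, E, j, H)` solves the structure-preserving semi-discrete scheme on `[0, ∞)` with coupling
parameter `τ` and initial value `B₀`; only the values at times `t ≥ 0` matter. In the second
equation the convergence of the integral (automatic for piecewise polynomial fields) is part of
the requirement. -/
structure IsSchemeSolution {Ω : Set E3} (X : DiscreteComplex Ω) (τ : ℝ) (B₀ : L2V Ω)
    (B E j H : ℝ → L2V Ω) : Prop where
  B_mem : ∀ t, 0 ≤ t → B t ∈ X.VDiv
  E_mem : ∀ t, 0 ≤ t → E t ∈ X.VCurl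
  j_mem : ∀ t, 0 ≤ t → j t ∈ X.VCurl
  H_mem : ∀ t, 0 ≤ t → H t ∈ X.VCurl
  B_contDiff : ContDiffOn ℝ 1 B (Ici 0)
  E_continuous : ContinuousOn E (Ici 0)
  j_continuous : ContinuousOn j (Ici 0)
  H_continuous : ContinuousOn H (Ici 0)
  initial : B 0 = B₀
  advection : ∀ t, 0 ≤ t → ∃ curlE, HasCurl0 Ω (E t) curlE ∧ ∀ C ∈ X.VDiv,
    inner ℝ (derivWithin B (Ici 0) t) C + inner ℝ curlE C = 0
  electric : ∀ t, 0 ≤ t → ∀ F ∈ X.VCurl,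
    IntegrableOn (fun x => inner ℝ (cross (cross (j t x) (H t x)) (H t x)) (F x)) Ω ∧
    inner ℝ (E t) F
      + τ * ∫ x in Ω, inner ℝ (cross (cross (j t x) (H t x)) (H t x)) (F x) = 0
  current : ∀ t, 0 ≤ t → ∀ K ∈ X.VCurl, ∀ curlK, HasCurl0 Ω K curlK →
    inner ℝ (j t) K = inner ℝ (B t) curlK
  auxiliary : ∀ t, 0 ≤ t → ∀ D ∈ X.VCurl, inner ℝ (H t) D = inner ℝ (B t) D

/-- The discrete energy `‖B‖²` (norm of `L²(Ω)`). -/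
def discreteEnergy {Ω : Set E3} (B : L2V Ω) : ℝ := ‖B‖ ^ 2

/-- `h` is the discrete helicity of `B`: there is a discrete magnetic potential `A ∈ H₀ʰ(curl)`,
`curl A = B`, and `(A, B) = h` whichever such potential is used. -/
def IsDiscreteHelicity {Ω : Set E3} (X : DiscreteComplex Ω) (B : L2V Ω) (h : ℝ) : Prop :=
  (∃ A ∈ X.VCurl, HasCurl0 Ω A B) ∧ ∀ A ∈ X.VCurl, HasCurl0 Ω A B → inner ℝ A B = h

end

noncomputable section

/-! The lower bound is Arnold's inequality: helicity is at most a constant times energy. It is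
proved without constructing a special potential. Let `A` be smooth and compactly supported, `B =
curl A`, and pull `A` back, as a one-form, by the dilation x ↦ tx. The number f(t) = ∫ t A(tx)·B(x)
dx joins f(0) = 0 to the helicity f(1). By Cartan's formula the t-derivative of t A(tx) is a
gradient, which `B` does not see, plus t B(tx) × x. If the support lies in the ball of radius `R`,
Cauchy–Schwarz and scaling in dimension three give |f'(t)| ≤ R ‖B‖² / √t, whose integral over (0, 1)
is 2R ‖B‖² (`abs_integral_inner_classicalCurl_le`). The boundary condition v × n = 0 says exactly
that extension by zero keeps the weak curl, so mollification carries this inequality, and the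
symmetry of the curl, to `HasCurl0`.

The rest is algebra of the scheme. Faraday's law holds strongly, B' = -curl E, since both terms lie
in the discrete H(div) space. As `H` is the projection of `B` on the discrete H(curl) space and (j ×
H) × H is orthogonal to `H`, (B, E) = (H, E) = 0, which conserves helicity. Likewise (j, E) = τ ‖j ×
H‖² ≥ 0, which makes the energy decrease. -/

/-! ### Mollification in L². -/

open Filter Topology in
/-- Translations act continuously on `L²`. -/
theorem tendsto_eLpNorm_translate_sub {f : E3 → E3} (hf : MemLp f 2 volume) :
    Tendsto (fun h => eLpNorm (fun x => f (x - h) - f x) 2 volume) (𝓝 0) (𝓝 0) := by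
  -- Translations preserve the measure and depend continuously on the vector in the compact-open
  -- topology; composition is then continuous into L².
  let g : E3 → C(E3, E3) := fun h => ⟨fun x => x - h, by fun_prop⟩
  have hg : Continuous g := ContinuousMap.continuous_of_continuous_uncurry _ (by
    change Continuous fun p : E3 × E3 => p.2 - p.1
    fun_prop)
  have hgm : ∀ h, MeasurePreserving (g h) (volume : Measure E3) volume := fun h =>
    measurePreserving_sub_right volume h
  have key := (continuous_const (y := hf.toLp f)).compMeasurePreservingLp hg hgm (by simp)
  have key0 := tendsto_iff_edist_tendsto_0.1 (key.tendsto 0)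
  refine key0.congr fun h => ?_
  have e : ∀ h, Lp.compMeasurePreserving (g h) (hgm h) (hf.toLp f)
      = (hf.comp_measurePreserving (hgm h)).toLp (f ∘ g h) := fun h =>
    Lp.toLp_compMeasurePreserving hf (hgm h)
  rw [e, e, Lp.edist_toLp_toLp]
  congr 1
  ext1 x
  simp [g]

/-- A smooth compactly supported approximation of the identity changes an `L²` field by at most as
much as the translations by vectors in its support. -/
theorem eLpNorm_normed_convolution_sub_le (φ : ContDiffBump (0 : E3)) {f : E3 → E3}
    (hfm : StronglyMeasurable f) (hf : MemLp f 2 volume) {ε : ENNReal}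
    (hε : ∀ h ∈ Metric.ball (0 : E3) φ.rOut,
      eLpNorm (fun x => f (x - h) - f x) 2 volume ≤ ε) :
    eLpNorm (fun x => convolution (φ.normed volume) f (ContinuousLinearMap.lsmul ℝ ℝ) volume x
      - f x) 2 volume ≤ ε := by
  set ρ := φ.normed (volume : Measure E3) with hρ
  have hρm : Measurable fun t => ENNReal.ofReal (ρ t) :=
    φ.continuous_normed.measurable.ennreal_ofReal
  -- With the bump read as a probability measure, the error of mollification is an average of the
  -- increments f(x - t) - f(x); Jensen and Tonelli then bound its L² norm.
  set ν : Measure E3 := volume.withDensity fun t => ENNReal.ofReal (ρ t) with hν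
  have hprob : IsProbabilityMeasure ν := by
    refine ⟨?_⟩
    rw [hν, withDensity_apply _ MeasurableSet.univ, setLIntegral_univ,
      ← ofReal_integral_eq_lintegral_ofReal φ.integrable_normed
        (Filter.Eventually.of_forall φ.nonneg_normed), φ.integral_normed, ENNReal.ofReal_one]
  have hconv : ∀ x, convolution ρ f (ContinuousLinearMap.lsmul ℝ ℝ) volume x - f x
      = ∫ t, (f (x - t) - f x) ∂ν := by
    intro x
    rw [hν, integral_withDensity_eq_integral_toReal_smul hρm
      (Filter.Eventually.of_forall fun _ => ENNReal.ofReal_lt_top), convolution_def]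
    have h1 : Integrable (fun t => ρ t • f (x - t)) :=
      φ.hasCompactSupport_normed.convolutionExists_left (ContinuousLinearMap.lsmul ℝ ℝ)
        φ.continuous_normed (hf.locallyIntegrable (by norm_num)) x
    have h2 : Integrable (fun t => ρ t • f x) := φ.integrable_normed.smul_const _
    conv_lhs => rw [← φ.integral_normed_smul volume (f x)]
    rw [← integral_sub (by simpa using h1) h2]
    refine integral_congr_ae (Filter.Eventually.of_forall fun t => ?_)
    simp [ENNReal.toReal_ofReal (φ.nonneg_normed t), smul_sub, hρ]
  have two : ∀ (μ : Measure E3) (g : E3 → E3),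
      eLpNorm g 2 μ ^ (2 : ℝ) = ∫⁻ x, ‖g x‖ₑ ^ (2 : ℝ) ∂μ := fun μ g => by
    simpa using eLpNorm_nnreal_pow_eq_lintegral (μ := μ) (f := g) (p := 2) two_ne_zero
  have hpt : ∀ x, ‖convolution ρ f (ContinuousLinearMap.lsmul ℝ ℝ) volume x - f x‖ₑ ^ (2 : ℝ)
      ≤ ∫⁻ t, ‖f (x - t) - f x‖ₑ ^ (2 : ℝ) ∂ν := by
    intro x
    rw [hconv x, ← two]
    gcongr
    refine (enorm_integral_le_lintegral_enorm _).trans ?_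
    rw [← eLpNorm_one_eq_lintegral_enorm]
    -- Jensen's inequality: on a probability space the L¹ norm is at most the L² norm.
    refine eLpNorm_le_eLpNorm_of_exponent_le (by norm_num) ?_
    exact ((hfm.comp_measurable (by fun_prop)).sub stronglyMeasurable_const).aestronglyMeasurable
  have hball : ∀ᵐ t ∂ν, t ∈ Metric.ball (0 : E3) φ.rOut := by
    rw [hν, ae_withDensity_iff hρm]
    refine Filter.Eventually.of_forall fun t ht => ?_
    rw [← φ.support_normed_eq (μ := volume), Function.mem_support]
    rintro h0
    simp [hρ, h0] at ht
  rw [← ENNReal.rpow_le_rpow_iff (z := 2) (by norm_num), two]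
  calc _ ≤ ∫⁻ x, ∫⁻ t, ‖f (x - t) - f x‖ₑ ^ (2 : ℝ) ∂ν := lintegral_mono hpt
    _ = ∫⁻ t, ∫⁻ x, ‖f (x - t) - f x‖ₑ ^ (2 : ℝ) ∂volume ∂ν := by
      refine lintegral_lintegral_swap (Measurable.aemeasurable ?_)
      refine Measurable.pow_const ?_ _
      refine StronglyMeasurable.enorm ?_
      exact (hfm.comp_measurable (measurable_fst.sub measurable_snd)).sub
        (hfm.comp_measurable measurable_fst)
    _ ≤ ∫⁻ t, ε ^ (2 : ℝ) ∂ν := by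
      refine lintegral_mono_ae ?_
      filter_upwards [hball] with t ht
      rw [← two]
      gcongr
      exact hε t ht
    _ = ε ^ (2 : ℝ) := by simp

/-! ### Curl and convolution on the whole space. -/

/-- The components of a curl, uniformly in the component. -/
theorem classicalCurl_apply (ψ : E3 → E3) (x : E3) (k : Fin 3) :
    classicalCurl ψ x k = pderiv (k + 1) (k + 2) ψ x - pderiv (k + 2) (k + 1) ψ x := by
  fin_cases k <;> simp [classicalCurl]

theorem inner_eq_sum_fin_three (a b : E3) : inner ℝ a b = a 0 * b 0 + a 1 * b 1 + a 2 * b 2 := by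
  simp [PiLp.inner_apply, Fin.sum_univ_three, mul_comm]

/-- Partial derivatives fall on the kernel of a convolution. -/
theorem pderiv_convolution {ρ : E3 → ℝ} (hρ : ContDiff ℝ ∞ ρ) (hρc : HasCompactSupport ρ)
    {V : E3 → E3} (hV : LocallyIntegrable V) (i k : Fin 3) (x : E3) :
    Integrable (fun y => fderiv ℝ ρ (x - y) (EuclideanSpace.single i 1) * V y k) ∧
    pderiv i k (convolution ρ V (ContinuousLinearMap.lsmul ℝ ℝ) volume) x
      = ∫ y, fderiv ℝ ρ (x - y) (EuclideanSpace.single i 1) * V y k := by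
  have h1 := hρc.hasFDerivAt_convolution_left (ContinuousLinearMap.lsmul ℝ ℝ) (μ := volume)
    (hρ.of_le (by simp)) hV x
  have hint : Integrable (fun t => ContinuousLinearMap.precompL E3
      (ContinuousLinearMap.lsmul ℝ ℝ) (fderiv ℝ ρ t) (V (x - t))) :=
    (hρc.fderiv ℝ).convolutionExists_left _ (hρ.continuous_fderiv (by simp)) hV x
  let ev : (E3 →L[ℝ] E3) →L[ℝ] ℝ := (EuclideanSpace.proj k).comp
    (ContinuousLinearMap.apply ℝ E3 (EuclideanSpace.single i 1))
  have hint2 := ev.integrable_comp hint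
  have e : ∀ t, ev (ContinuousLinearMap.precompL E3
      (ContinuousLinearMap.lsmul ℝ ℝ) (fderiv ℝ ρ t) (V (x - t)))
      = (fun y => fderiv ℝ ρ (x - y) (EuclideanSpace.single i 1) * V y k) (x - t) := by
    intro t
    simp [ev, ContinuousLinearMap.precompL_apply]
  simp only [e] at hint2
  refine ⟨(integrable_comp_sub_left _ x).1 hint2, ?_⟩
  have h2 : pderiv i k (convolution ρ V (ContinuousLinearMap.lsmul ℝ ℝ) volume) x
      = ev (fderiv ℝ (convolution ρ V (ContinuousLinearMap.lsmul ℝ ℝ) volume) x) := rfl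
  rw [h2, h1.fderiv, convolution_def, ← ev.integral_comp_comm hint]
  simp only [e]
  exact integral_sub_left_eq_self
    (fun y => fderiv ℝ ρ (x - y) (EuclideanSpace.single i 1) * V y k) volume x

/-- `W` is the weak curl of `V` on the whole space, tested against arbitrary smooth fields. -/
structure IsCurlPair (V W : E3 → E3) : Prop where
  memLp_left : MemLp V 2 volume
  memLp_right : MemLp W 2 volume
  integral_eq : ∀ ψ : E3 → E3, ContDiff ℝ ∞ ψ →
    ∫ x, inner ℝ (W x) (ψ x) = ∫ x, inner ℝ (V x) (classicalCurl ψ x)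

/-- Convolution commutes with the curl. -/
theorem IsCurlPair.classicalCurl_convolution {V W : E3 → E3} (h : IsCurlPair V W) {ρ : E3 → ℝ}
    (hρ : ContDiff ℝ ∞ ρ) (hρc : HasCompactSupport ρ) (x : E3) :
    classicalCurl (convolution ρ V (ContinuousLinearMap.lsmul ℝ ℝ) volume) x
      = convolution ρ W (ContinuousLinearMap.lsmul ℝ ℝ) volume x := by
  have hVl : LocallyIntegrable V := h.memLp_left.locallyIntegrable (by norm_num)
  have hWl : LocallyIntegrable W := h.memLp_right.locallyIntegrable (by norm_num)
  ext k
  -- Testing the weak curl with the reflected, translated kernel times the `k`-th basis vector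
  -- yields the `k`-th component of the convolution at `x`.
  set ψ : E3 → E3 := fun y => ρ (x - y) • EuclideanSpace.single k (1 : ℝ) with hψ
  have hψs : ContDiff ℝ ∞ ψ := (hρ.comp (contDiff_const.sub contDiff_id)).smul contDiff_const
  have hd : ∀ i l y, pderiv i l ψ y = -(fderiv ℝ ρ (x - y) (EuclideanSpace.single i 1))
      * (EuclideanSpace.single k (1 : ℝ) : E3) l := by
    intro i l y
    have h1 : HasFDerivAt (fun y => ρ (x - y))
        ((fderiv ℝ ρ (x - y)).comp (-ContinuousLinearMap.id ℝ E3)) y :=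
      ((hρ.differentiable (by simp)) (x - y)).hasFDerivAt.comp y
        ((hasFDerivAt_id y).const_sub x)
    have h2 := h1.smul_const (EuclideanSpace.single k (1 : ℝ))
    rw [pderiv, h2.fderiv]
    by_cases hl : l = k <;> simp [hl]
  have hR : convolution ρ W (ContinuousLinearMap.lsmul ℝ ℝ) volume x k
      = ∫ y, inner ℝ (W y) (ψ y) := by
    have hint : Integrable (fun t => ρ t • W (x - t)) :=
      hρc.convolutionExists_left (ContinuousLinearMap.lsmul ℝ ℝ) hρ.continuous hWl x
    have e1 : convolution ρ W (ContinuousLinearMap.lsmul ℝ ℝ) volume x k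
        = (EuclideanSpace.proj k : E3 →L[ℝ] ℝ) (∫ t, ρ t • W (x - t)) := rfl
    rw [e1, ← ContinuousLinearMap.integral_comp_comm _ hint,
      ← integral_sub_left_eq_self (fun y => inner ℝ (W y) (ψ y)) volume x]
    refine integral_congr_ae (Filter.Eventually.of_forall fun t => ?_)
    simp [hψ, inner_smul_right, EuclideanSpace.inner_single_right]
  rw [hR, h.integral_eq ψ hψs, classicalCurl_apply,
    (pderiv_convolution hρ hρc hVl _ _ x).2, (pderiv_convolution hρ hρc hVl _ _ x).2,
    ← integral_sub (pderiv_convolution hρ hρc hVl _ _ x).1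
      (pderiv_convolution hρ hρc hVl _ _ x).1]
  refine integral_congr_ae (Filter.Eventually.of_forall fun y => ?_)
  simp only [inner_eq_sum_fin_three, classicalCurl_apply, hd]
  fin_cases k <;> simp <;> ring

/-! ### Smooth fields -/

theorem cross_apply_zero (a b : E3) : cross a b 0 = a 1 * b 2 - a 2 * b 1 := by
  simp [cross, cross_apply]

theorem cross_apply_one (a b : E3) : cross a b 1 = a 2 * b 0 - a 0 * b 2 := by
  simp [cross, cross_apply]

theorem cross_apply_two (a b : E3) : cross a b 2 = a 0 * b 1 - a 1 * b 0 := by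
  simp [cross, cross_apply]

theorem norm_sq_eq_sum_fin_three (a : E3) : ‖a‖ ^ 2 = a 0 ^ 2 + a 1 ^ 2 + a 2 ^ 2 := by
  simp [EuclideanSpace.norm_sq_eq, Fin.sum_univ_three]

/-- Lagrange's identity: |a × b|² + (a·b)² = |a|² |b|². -/
theorem norm_cross_le (a b : E3) : ‖cross a b‖ ≤ ‖a‖ * ‖b‖ := by
  refine le_of_sq_le_sq ?_ (by positivity)
  rw [mul_pow, norm_sq_eq_sum_fin_three, norm_sq_eq_sum_fin_three, norm_sq_eq_sum_fin_three,
    cross_apply_zero, cross_apply_one, cross_apply_two]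
  nlinarith [sq_nonneg (a 0 * b 0 + a 1 * b 1 + a 2 * b 2)]

/-- Cyclicity of the triple product. This sign makes the coupling term of the scheme dissipative. -/
theorem inner_cross_cross_left (a b : E3) : inner ℝ (cross (cross a b) b) a = -‖cross a b‖ ^ 2 := by
  rw [norm_sq_eq_sum_fin_three, inner_eq_sum_fin_three]
  simp only [cross_apply_zero, cross_apply_one, cross_apply_two]
  ring

theorem inner_cross_self_right (a b : E3) : inner ℝ (cross a b) b = 0 := by
  rw [inner_eq_sum_fin_three, cross_apply_zero, cross_apply_one, cross_apply_two]
  ring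

theorem continuous_pderiv {ψ : E3 → E3} (hψ : ContDiff ℝ ∞ ψ) (i k : Fin 3) :
    Continuous (pderiv i k ψ) := by
  have := (hψ.continuous_fderiv (by simp)).clm_apply
    (continuous_const (y := (EuclideanSpace.single i 1 : E3)))
  exact (EuclideanSpace.proj k : E3 →L[ℝ] ℝ).continuous.comp this

theorem continuous_classicalCurl {ψ : E3 → E3} (hψ : ContDiff ℝ ∞ ψ) :
    Continuous (classicalCurl ψ) := by
  refine (PiLp.continuous_toLp 2 _).comp (continuous_pi fun k => ?_)
  have := fun i k => continuous_pderiv hψ i k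
  fin_cases k <;> simp <;> fun_prop

theorem support_classicalCurl_subset (ψ : E3 → E3) :
    Function.support (classicalCurl ψ) ⊆ tsupport ψ := by
  intro x hx
  by_contra h
  refine hx ?_
  have h0 : fderiv ℝ ψ x = 0 := by
    by_contra h1
    exact h (support_fderiv_subset ℝ h1)
  ext k
  simp [classicalCurl_apply, pderiv, h0]

theorem hasCompactSupport_classicalCurl {ψ : E3 → E3} (hψ : HasCompactSupport ψ) :
    HasCompactSupport (classicalCurl ψ) :=
  HasCompactSupport.of_support_subset_isCompact hψ (support_classicalCurl_subset ψ)

theorem fderiv_component {ψ : E3 → E3} (hψ : ContDiff ℝ ∞ ψ) (k : Fin 3) (x v : E3) :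
    fderiv ℝ (fun y => ψ y k) x v = fderiv ℝ ψ x v k := by
  have h := (EuclideanSpace.proj k : E3 →L[ℝ] ℝ).hasFDerivAt.comp x
    ((hψ.differentiable (by simp)) x).hasFDerivAt
  have h' : HasFDerivAt (fun y => ψ y k)
    ((EuclideanSpace.proj k : E3 →L[ℝ] ℝ).comp (fderiv ℝ ψ x)) x := h
  rw [h'.fderiv]
  rfl

/-- Integration by parts for the components of smooth fields. -/
theorem integral_mul_pderiv {ψ A : E3 → E3} (hψ : ContDiff ℝ ∞ ψ) (hA : ContDiff ℝ ∞ A)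
    (hAc : HasCompactSupport A) (i k l : Fin 3) :
    Integrable (fun x => ψ x k * pderiv i l A x) ∧ Integrable (fun x => pderiv i k ψ x * A x l) ∧
    ∫ x, ψ x k * pderiv i l A x = - ∫ x, pderiv i k ψ x * A x l := by
  have hψk : ContDiff ℝ ∞ fun x => ψ x k := (EuclideanSpace.proj k : E3 →L[ℝ] ℝ).contDiff.comp hψ
  have hAl : ContDiff ℝ ∞ fun x => A x l := (EuclideanSpace.proj l : E3 →L[ℝ] ℝ).contDiff.comp hA
  have hAlc : HasCompactSupport fun x => A x l :=
    hAc.comp_left (g := fun a : E3 => a l) rfl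
  have hAdc : HasCompactSupport (pderiv i l A) :=
    (hAc.fderiv ℝ).comp_left (g := fun a : E3 →L[ℝ] E3 => a (EuclideanSpace.single i 1) l) rfl
  have i1 : Integrable (fun x => ψ x k * pderiv i l A x) :=
    (hψk.continuous.mul (continuous_pderiv hA i l)).integrable_of_hasCompactSupport hAdc.mul_left
  have i2 : Integrable (fun x => pderiv i k ψ x * A x l) :=
    ((continuous_pderiv hψ i k).mul hAl.continuous).integrable_of_hasCompactSupport hAlc.mul_left
  have i3 : Integrable (fun x => ψ x k * A x l) :=
    (hψk.continuous.mul hAl.continuous).integrable_of_hasCompactSupport hAlc.mul_left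
  refine ⟨i1, i2, ?_⟩
  have e1 : ∀ x, pderiv i k ψ x = fderiv ℝ (fun x => ψ x k) x (EuclideanSpace.single i 1) :=
    fun x => (fderiv_component hψ k x _).symm
  have e2 : ∀ x, pderiv i l A x = fderiv ℝ (fun x => A x l) x (EuclideanSpace.single i 1) :=
    fun x => (fderiv_component hA l x _).symm
  simp only [e1, e2] at i1 i2 ⊢
  exact integral_mul_fderiv_eq_neg_fderiv_mul_of_integrable i2 i1 i3
    (fun x _ => hψk.differentiable (by simp) x) (fun x _ => hAl.differentiable (by simp) x)

theorem integral_sum_three_sub {f₁ g₁ f₂ g₂ f₃ g₃ : E3 → ℝ} (hf₁ : Integrable f₁)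
    (hg₁ : Integrable g₁) (hf₂ : Integrable f₂) (hg₂ : Integrable g₂) (hf₃ : Integrable f₃)
    (hg₃ : Integrable g₃) :
    ∫ x, ((f₁ x - g₁ x) + (f₂ x - g₂ x) + (f₃ x - g₃ x))
      = (∫ x, f₁ x) - (∫ x, g₁ x) + ((∫ x, f₂ x) - ∫ x, g₂ x) + ((∫ x, f₃ x) - ∫ x, g₃ x) := by
  have h₁ := hf₁.sub hg₁
  have h₂ := hf₂.sub hg₂
  have h₃ := hf₃.sub hg₃
  have e := integral_add (h₁.add h₂) h₃
  have e' := integral_add h₁ h₂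
  rw [← integral_sub hf₁ hg₁, ← integral_sub hf₂ hg₂, ← integral_sub hf₃ hg₃]
  exact e.trans (congrArg (· + _) e')

/-- Green's formula for smooth fields, one of them compactly supported. -/
theorem integral_inner_classicalCurl {ψ A : E3 → E3} (hψ : ContDiff ℝ ∞ ψ) (hA : ContDiff ℝ ∞ A)
    (hAc : HasCompactSupport A) :
    ∫ x, inner ℝ (ψ x) (classicalCurl A x) = ∫ x, inner ℝ (classicalCurl ψ x) (A x) := by
  have H := integral_mul_pderiv hψ hA hAc
  have a := fun i k l => (H i k l).1
  have b := fun i k l => (H i k l).2.1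
  have e1 : ∀ x, inner ℝ (ψ x) (classicalCurl A x) =
      (ψ x 0 * pderiv 1 2 A x - ψ x 0 * pderiv 2 1 A x)
      + (ψ x 1 * pderiv 2 0 A x - ψ x 1 * pderiv 0 2 A x)
      + (ψ x 2 * pderiv 0 1 A x - ψ x 2 * pderiv 1 0 A x) := fun x => by
    simp [inner_eq_sum_fin_three, classicalCurl]; ring
  have e2 : ∀ x, inner ℝ (classicalCurl ψ x) (A x) =
      (pderiv 1 2 ψ x * A x 0 - pderiv 2 1 ψ x * A x 0)
      + (pderiv 2 0 ψ x * A x 1 - pderiv 0 2 ψ x * A x 1)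
      + (pderiv 0 1 ψ x * A x 2 - pderiv 1 0 ψ x * A x 2) := fun x => by
    simp [inner_eq_sum_fin_three, classicalCurl]; ring
  simp only [e1, e2]
  rw [integral_sum_three_sub (a _ _ _) (a _ _ _) (a _ _ _) (a _ _ _) (a _ _ _) (a _ _ _),
    integral_sum_three_sub (b _ _ _) (b _ _ _) (b _ _ _) (b _ _ _) (b _ _ _) (b _ _ _)]
  simp only [(H _ _ _).2.2]
  ring

theorem contDiff_gradient {G : E3 → ℝ} (hG : ContDiff ℝ ∞ G) : ContDiff ℝ ∞ (gradient G) :=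
  (InnerProductSpace.toDual ℝ E3).symm.contDiff.comp (hG.fderiv_right (by simp))

theorem gradient_apply {G : E3 → ℝ} (x : E3) (k : Fin 3) :
    gradient G x k = fderiv ℝ G x (EuclideanSpace.single k 1) := by
  have : gradient G x k = inner ℝ (gradient G x) (EuclideanSpace.single k 1) := by
    rw [EuclideanSpace.inner_single_right]
    simp
  rw [this, gradient, InnerProductSpace.toDual_symm_apply]

/-- Symmetry of the second derivative. -/
theorem classicalCurl_gradient {G : E3 → ℝ} (hG : ContDiff ℝ ∞ G) (x : E3) :
    classicalCurl (gradient G) x = 0 := by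
  have hsymm : IsSymmSndFDerivAt ℝ G x :=
    (contDiff_infty.1 hG 2).contDiffAt.isSymmSndFDerivAt (by simp)
  have e : ∀ i k, pderiv i k (gradient G) x = fderiv ℝ (fderiv ℝ G) x
      (EuclideanSpace.single i 1) (EuclideanSpace.single k 1) := by
    intro i k
    rw [pderiv, ← fderiv_component (contDiff_gradient hG)]
    simp only [gradient_apply]
    have h : HasFDerivAt (fderiv ℝ G) (fderiv ℝ (fderiv ℝ G) x) x :=
      ((hG.fderiv_right (m := ∞) (by simp)).differentiable (by simp) x).hasFDerivAt
    have h' := h.clm_apply (hasFDerivAt_const (EuclideanSpace.single k 1 : E3) x)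
    rw [h'.fderiv]
    simp
  ext k
  simp [classicalCurl_apply, e, hsymm.eq (EuclideanSpace.single (k + 1) 1)]

/-- A compactly supported curl is orthogonal to gradients. -/
theorem integral_inner_gradient_classicalCurl {G : E3 → ℝ} {A : E3 → E3} (hG : ContDiff ℝ ∞ G)
    (hA : ContDiff ℝ ∞ A) (hAc : HasCompactSupport A) :
    ∫ x, inner ℝ (gradient G x) (classicalCurl A x) = 0 := by
  rw [integral_inner_classicalCurl (contDiff_gradient hG) hA hAc]
  simp [classicalCurl_gradient hG]

/-! ### Arnold's inequality for smooth fields, by dilations. -/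

/-- Cartan's formula for the dilations: the velocity of `t A(t x)` is a gradient plus
`t (curl A)(t x) × x`. -/
theorem dilation_velocity_eq {A : E3 → E3} (hA : ContDiff ℝ ∞ A) (t : ℝ) (x : E3) :
    A (t • x) + t • fderiv ℝ A (t • x) x
      = gradient (fun y => inner ℝ y (A (t • y))) x
        + t • cross (classicalCurl A (t • x)) x := by
  have hAt : HasFDerivAt (fun y => A (t • y)) (t • fderiv ℝ A (t • x)) x := by
    have h := (hA.differentiable (by simp) (t • x)).hasFDerivAt.comp x
      ((hasFDerivAt_id x).const_smul t)
    refine h.congr_fderiv ?_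
    ext v
    simp
  have hG := (hasFDerivAt_id x).inner ℝ hAt
  have hx : x = ∑ i, x i • (EuclideanSpace.single i 1 : E3) := by
    ext k
    fin_cases k <;> simp [Fin.sum_univ_three]
  have hD : ∀ k, fderiv ℝ A (t • x) x k = ∑ i, x i * pderiv i k A (t • x) := by
    intro k
    calc fderiv ℝ A (t • x) x k
        = fderiv ℝ A (t • x) (∑ i, x i • (EuclideanSpace.single i 1 : E3)) k := by rw [← hx]
      _ = _ := by
        rw [map_sum]
        simp [pderiv]
  have hgrad : ∀ k, gradient (fun y => inner ℝ y (A (t • y))) x k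
      = A (t • x) k + t * ∑ i, x i * pderiv k i A (t • x) := by
    intro k
    have hG' : HasFDerivAt (fun y => inner ℝ y (A (t • y))) _ x := hG
    rw [gradient_apply, hG'.fderiv]
    simp only [ContinuousLinearMap.comp_apply, ContinuousLinearMap.prod_apply,
      fderivInnerCLM_apply, id, _root_.smul_apply, inner_smul_right,
      ContinuousLinearMap.id_apply, EuclideanSpace.inner_single_left, inner_eq_sum_fin_three,
      pderiv, Fin.sum_univ_three]
    simp
    ring
  -- The two sides differ through t Σᵢ xᵢ (∂ᵢAₖ - ∂ₖAᵢ), the `k`-th component of t (curl A) × x.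
  ext k
  simp only [PiLp.add_apply, PiLp.smul_apply, hD, hgrad, smul_eq_mul, Fin.sum_univ_three]
  fin_cases k <;> simp [cross_apply_zero, cross_apply_one, cross_apply_two, classicalCurl] <;> ring

/-- Differentiation of the helicity along dilations. -/
theorem hasDerivAt_integral_inner_dilation {A B : E3 → E3} (hA : ContDiff ℝ ∞ A)
    (hB : Continuous B) (hBc : HasCompactSupport B) (t₀ : ℝ) :
    HasDerivAt (fun t : ℝ => ∫ x, inner ℝ (t • A (t • x)) (B x))
      (∫ x, inner ℝ (A (t₀ • x) + t₀ • fderiv ℝ A (t₀ • x) x) (B x)) t₀ := by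
  have hA' := hA.continuous_fderiv (by simp)
  have hAc := hA.continuous
  have hF' : Continuous fun p : ℝ × E3 =>
      inner ℝ (A (p.1 • p.2) + p.1 • fderiv ℝ A (p.1 • p.2) p.2) (B p.2) := by
    have h0 : Continuous fun p : ℝ × E3 => p.1 • p.2 := continuous_fst.smul continuous_snd
    have h1 : Continuous fun p : ℝ × E3 => fderiv ℝ A (p.1 • p.2) p.2 :=
      (hA'.comp h0).clm_apply continuous_snd
    have h2 : Continuous fun p : ℝ × E3 => p.1 • fderiv ℝ A (p.1 • p.2) p.2 :=
      continuous_fst.smul h1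
    have h3 : Continuous fun p : ℝ × E3 => A (p.1 • p.2) := hAc.comp h0
    have h4 : Continuous fun p : ℝ × E3 => B p.2 := hB.comp continuous_snd
    exact (h3.add h2).inner h4
  have hF'0 : ∀ t : ℝ, Continuous fun x : E3 =>
      inner ℝ (A (t • x) + t • fderiv ℝ A (t • x) x) (B x) := by
    intro t
    have h0 : Continuous fun x : E3 => t • x := continuous_const_smul t
    have h1 : Continuous fun x : E3 => fderiv ℝ A (t • x) x := (hA'.comp h0).clm_apply continuous_id
    exact ((hAc.comp h0).add (h1.const_smul t)).inner hB
  have hF0 : ∀ t : ℝ, Continuous fun x : E3 => inner ℝ (t • A (t • x)) (B x) := fun t =>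
    ((hAc.comp (continuous_const_smul t)).const_smul t).inner hB
  -- The integrand vanishes off the support of `B`, so a bound on a compact set of pairs (t, x)
  -- dominates it.
  obtain ⟨c, hcb⟩ := (isCompact_Icc.prod (hBc : IsCompact (tsupport B))).exists_bound_of_continuousOn
    (s := Icc (t₀ - 1) (t₀ + 1) ×ˢ tsupport B) hF'.continuousOn
  refine (hasDerivAt_integral_of_dominated_loc_of_deriv_le
    (F := fun t x => inner ℝ (t • A (t • x)) (B x))
    (F' := fun t x => inner ℝ (A (t • x) + t • fderiv ℝ A (t • x) x) (B x))
    (s := Icc (t₀ - 1) (t₀ + 1))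
    (bound := (tsupport B).indicator fun _ => c) (Icc_mem_nhds (by linarith) (by linarith))
    (Filter.Eventually.of_forall fun t => (hF0 t).aestronglyMeasurable)
    ((hF0 t₀).integrable_of_hasCompactSupport ?_) (hF'0 t₀).aestronglyMeasurable ?_ ?_ ?_).2
  · refine hBc.mono fun x hx => ?_
    contrapose! hx
    simp [Function.notMem_support.1 hx]
  · refine Filter.Eventually.of_forall fun x t ht => ?_
    by_cases hx : x ∈ tsupport B
    · rw [indicator_of_mem hx]
      exact hcb (t, x) ⟨ht, hx⟩
    · rw [indicator_of_notMem hx, image_eq_zero_of_notMem_tsupport hx]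
      simp
  · exact (integrable_indicator_iff (isClosed_tsupport B).measurableSet).2
      (integrableOn_const (hBc : IsCompact (tsupport B)).measure_lt_top.ne)
  · refine Filter.Eventually.of_forall fun x t _ => ?_
    have h1 : HasDerivAt (fun t : ℝ => A (t • x)) (fderiv ℝ A (t • x) x) t := by
      have := (hA.differentiable (by simp) (t • x)).hasFDerivAt.comp_hasDerivAt t
        ((hasDerivAt_id t).smul_const x)
      exact this.congr_deriv (by simp)
    have h2 := ((hasDerivAt_id t).smul h1).inner ℝ (hasDerivAt_const t (B x))
    simpa [add_comm] using h2

/-- The rate of change of the helicity along dilations. -/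
theorem abs_integral_inner_cross_dilation_le {B : E3 → E3} (hB : Continuous B)
    (hBc : HasCompactSupport B) {R : ℝ} (hR : 0 ≤ R) (hBR : ∀ x, B x ≠ 0 → ‖x‖ ≤ R)
    {t : ℝ} (ht : 0 < t) :
    |∫ x, inner ℝ (t • cross (B (t • x)) x) (B x)| ≤ R * (∫ x, ‖B x‖ ^ 2) / √t := by
  set s := √t with hs
  have hs0 : 0 < s := Real.sqrt_pos.2 ht
  have hst : t = s ^ 2 := (Real.sq_sqrt ht.le).symm
  have i1 : Integrable fun x => ‖B x‖ ^ 2 :=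
    (by fun_prop : Continuous fun x => ‖B x‖ ^ 2).integrable_of_hasCompactSupport
      (hBc.comp_left (g := fun b => ‖b‖ ^ 2) (by simp))
  have i2 : Integrable fun x => ‖B (t • x)‖ ^ 2 := i1.comp_smul ht.ne'
  have hpt : ∀ x, ‖inner ℝ (t • cross (B (t • x)) x) (B x)‖
      ≤ t * R / 2 * (s ^ 3 * ‖B (t • x)‖ ^ 2 + (s ^ 3)⁻¹ * ‖B x‖ ^ 2) := by
    intro x
    -- The weight t^{3/2} makes both terms contribute equally after integration, because ∫ ‖B(tx)‖²
    -- = t⁻³ ∫ ‖B‖²; the result is as sharp as Cauchy–Schwarz.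
    have hAMGM : ‖B (t • x)‖ * ‖B x‖
        ≤ (s ^ 3 * ‖B (t • x)‖ ^ 2 + (s ^ 3)⁻¹ * ‖B x‖ ^ 2) / 2 := by
      have h3 : 0 < s ^ 3 := by positivity
      have : 0 ≤ (s ^ 3)⁻¹ * (s ^ 3 * ‖B (t • x)‖ - ‖B x‖) ^ 2 := by positivity
      have e : (s ^ 3)⁻¹ * (s ^ 3 * ‖B (t • x)‖ - ‖B x‖) ^ 2
          = s ^ 3 * ‖B (t • x)‖ ^ 2 + (s ^ 3)⁻¹ * ‖B x‖ ^ 2 - 2 * (‖B (t • x)‖ * ‖B x‖) := by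
        field_simp
        ring
      linarith
    by_cases hx : B x = 0
    · rw [hx]
      simp only [inner_zero_right, norm_zero]
      positivity
    calc ‖inner ℝ (t • cross (B (t • x)) x) (B x)‖
        ≤ ‖t • cross (B (t • x)) x‖ * ‖B x‖ := norm_inner_le_norm _ _
      _ ≤ t * (‖B (t • x)‖ * R) * ‖B x‖ := by
        rw [norm_smul, Real.norm_of_nonneg ht.le]
        gcongr
        exact (norm_cross_le _ _).trans (by gcongr; exact hBR x hx)
      _ = t * R * (‖B (t • x)‖ * ‖B x‖) := by ring
      _ ≤ t * R * ((s ^ 3 * ‖B (t • x)‖ ^ 2 + (s ^ 3)⁻¹ * ‖B x‖ ^ 2) / 2) := by gcongr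
      _ = _ := by ring
  have hscale : ∫ x, ‖B (t • x)‖ ^ 2 = (t ^ 3)⁻¹ * ∫ x, ‖B x‖ ^ 2 := by
    have h := Measure.integral_comp_smul (volume : Measure E3) (fun x => ‖B x‖ ^ 2) t
    rw [h, finrank_euclideanSpace_fin, smul_eq_mul, abs_of_pos (by positivity)]
  rw [← Real.norm_eq_abs]
  refine (norm_integral_le_of_norm_le
    (((i2.const_mul (s ^ 3)).add (i1.const_mul (s ^ 3)⁻¹)).const_mul (t * R / 2))
    (Filter.Eventually.of_forall hpt)).trans (le_of_eq ?_)
  simp only [Pi.add_apply]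
  rw [integral_const_mul, integral_add (i2.const_mul _) (i1.const_mul _), integral_const_mul,
    integral_const_mul, hscale, hst]
  field_simp
  ring

/-- **Arnold's inequality** for smooth compactly supported fields: the helicity is controlled by the
energy. -/
theorem abs_integral_inner_classicalCurl_le {A : E3 → E3} (hA : ContDiff ℝ ∞ A)
    (hAc : HasCompactSupport A) {R : ℝ} (hR : 0 ≤ R) (hAR : ∀ x ∈ tsupport A, ‖x‖ ≤ R) :
    |∫ x, inner ℝ (A x) (classicalCurl A x)| ≤ 2 * R * ∫ x, ‖classicalCurl A x‖ ^ 2 := by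
  set B := classicalCurl A with hBdef
  have hB : Continuous B := continuous_classicalCurl hA
  have hBc : HasCompactSupport B := hasCompactSupport_classicalCurl hAc
  have hBR : ∀ x, B x ≠ 0 → ‖x‖ ≤ R := fun x hx => hAR x (support_classicalCurl_subset A hx)
  set M := ∫ x, ‖B x‖ ^ 2 with hM
  set f : ℝ → ℝ := fun t => ∫ x, inner ℝ (t • A (t • x)) (B x) with hf
  have hfd := hasDerivAt_integral_inner_dilation hA hB hBc
  have hfd' : ∀ t, 0 < t → |deriv f t| ≤ R * M / √t := by
    intro t ht
    rw [(hfd t).deriv]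
    refine le_trans (le_of_eq ?_) (abs_integral_inner_cross_dilation_le hB hBc hR hBR ht)
    congr 1
    have hG : ContDiff ℝ ∞ fun y : E3 => inner ℝ y (A (t • y)) :=
      contDiff_id.inner ℝ (hA.comp (contDiff_const_smul t))
    have hcr : Continuous fun x : E3 => cross (B (t • x)) x := by
      refine (PiLp.continuous_toLp 2 _).comp (continuous_pi fun k => ?_)
      fin_cases k <;> simp [cross_apply] <;> fun_prop
    have hsupp : ∀ Φ : E3 → E3, Continuous Φ → Integrable fun x => inner ℝ (Φ x) (B x) := by
      intro Φ hΦ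
      refine (hΦ.inner hB).integrable_of_hasCompactSupport (hBc.mono fun x hx => ?_)
      contrapose! hx
      simp [Function.notMem_support.1 hx]
    have i2 : Integrable fun x => inner ℝ (t • cross (B (t • x)) x) (B x) :=
      hsupp _ (hcr.const_smul t)
    simp only [dilation_velocity_eq hA, inner_add_left, ← hBdef]
    rw [integral_add (hsupp _ (contDiff_gradient hG).continuous) i2,
      integral_inner_gradient_classicalCurl hG hA hAc, zero_add]
  have hfc : Continuous f := continuous_iff_continuousAt.2 fun t => (hfd t).continuousAt
  have hgd : ∀ t : ℝ, 0 < t → HasDerivAt (fun t => 2 * R * M * √t) (R * M / √t) t := by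
    intro t ht
    refine ((Real.hasDerivAt_sqrt ht.ne').const_mul (2 * R * M)).congr_deriv ?_
    field_simp
  have hgc : Continuous fun t : ℝ => 2 * R * M * √t := by fun_prop
  have f0 : f 0 = 0 := by simp [hf]
  have f1 : f 1 = ∫ x, inner ℝ (A x) (B x) := by simp [hf]
  -- The derivative bound is singular at 0. Instead of integrating it, compare with its primitive:
  -- 2RM√t ± f(t) is continuous on [0, 1] and nondecreasing.
  have up : ∀ σ : ℝ, |σ| = 1 → 0 ≤ 2 * R * M + σ * f 1 := by
    intro σ hσ
    have hmono : MonotoneOn (fun t => 2 * R * M * √t + σ * f t) (Icc 0 1) := by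
      have hd : ∀ t ∈ interior (Icc (0 : ℝ) 1), HasDerivAt (fun t => 2 * R * M * √t + σ * f t)
          (R * M / √t + σ * deriv f t) t := by
        intro t ht
        rw [interior_Icc] at ht
        exact (hgd t ht.1).add ((hfd t).differentiableAt.hasDerivAt.const_mul σ)
      refine monotoneOn_of_deriv_nonneg (convex_Icc 0 1) (by fun_prop)
        (fun t ht => (hd t ht).differentiableAt.differentiableWithinAt) fun t ht => ?_
      rw [(hd t ht).deriv]
      rw [interior_Icc] at ht
      have h1 := hfd' t ht.1
      have h2 : |σ * deriv f t| = |deriv f t| := by rw [abs_mul, hσ, one_mul]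
      have h3 := neg_abs_le (σ * deriv f t)
      linarith
    have := hmono (left_mem_Icc.2 zero_le_one) (right_mem_Icc.2 zero_le_one) zero_le_one
    simpa [f0] using this
  rw [← f1, abs_le]
  constructor
  · have := up 1 (by simp)
    linarith
  · have := up (-1) (by simp)
    linarith

/-! ### From smooth fields to weak curls. -/

/-- A standard sequence of bump functions shrinking to the origin. -/
def shrinkingBump (n : ℕ) : ContDiffBump (0 : E3) where
  rIn := 1 / (n + 1) / 2
  rOut := 1 / (n + 1)
  rIn_pos := by positivity
  rIn_lt_rOut := half_lt_self (by positivity)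

/-- Mollification with the sequence of bump functions `shrinkingBump`. -/
def mollify (n : ℕ) (V : E3 → E3) : E3 → E3 :=
  convolution ((shrinkingBump n).normed volume) V (ContinuousLinearMap.lsmul ℝ ℝ) volume

open Filter Topology in
theorem tendsto_eLpNorm_mollify_sub {V : E3 → E3} (hVm : StronglyMeasurable V)
    (hV : MemLp V 2 volume) :
    Tendsto (fun n => eLpNorm (mollify n V - V) 2 volume) atTop (𝓝 0) := by
  rw [ENNReal.tendsto_atTop_zero]
  intro ε hε
  obtain ⟨δ, hδ, hball⟩ := Metric.eventually_nhds_iff_ball.1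
    ((tendsto_eLpNorm_translate_sub hV).eventually (Iic_mem_nhds hε))
  obtain ⟨N, hN⟩ := exists_nat_one_div_lt hδ
  refine ⟨N, fun n hn => eLpNorm_normed_convolution_sub_le (shrinkingBump n) hVm hV fun h hh => ?_⟩
  refine hball h (Metric.ball_subset_ball ?_ hh)
  exact (Nat.one_div_le_one_div hn).trans hN.le

theorem contDiff_mollify {V : E3 → E3} (hV : MemLp V 2 volume) (n : ℕ) :
    ContDiff ℝ ∞ (mollify n V) :=
  (shrinkingBump n).hasCompactSupport_normed.contDiff_convolution_left _
    (shrinkingBump n).contDiff_normed (hV.locallyIntegrable (by norm_num))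

/-- All bump radii 1/(n + 1) are at most 1, so one ball serves every `n`; this is the source of `R +
1` in the final constant. -/
theorem tsupport_mollify_subset {V : E3 → E3} {R : ℝ} (hVR : ∀ x, V x ≠ 0 → ‖x‖ ≤ R) (n : ℕ) :
    tsupport (mollify n V) ⊆ Metric.closedBall 0 (R + 1) := by
  refine closure_minimal (fun x hx => ?_) Metric.isClosed_closedBall
  obtain ⟨a, ha, b, hb, rfl⟩ := Set.mem_add.1 (support_convolution_subset _ hx)
  rw [ContDiffBump.support_normed_eq] at ha
  have h1 : ‖a‖ ≤ 1 := by
    have h2 : ‖a‖ < 1 / ((n : ℝ) + 1) := mem_ball_zero_iff.1 ha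
    have h3 : 1 / ((n : ℝ) + 1) ≤ 1 := by
      rw [div_le_one (by positivity)]
      linarith [n.cast_nonneg (α := ℝ)]
    linarith
  rw [mem_closedBall_zero_iff]
  linarith [norm_add_le a b, hVR b hb]

open Filter Topology in
/-- Fields with a weak curl and bounded support are limits of smooth fields, together with their
curls. -/
theorem IsCurlPair.exists_smooth_approx {V W : E3 → E3} (h : IsCurlPair V W)
    (hVm : StronglyMeasurable V) (hWm : StronglyMeasurable W) {R : ℝ}
    (hVR : ∀ x, V x ≠ 0 → ‖x‖ ≤ R) :
    ∃ A : ℕ → E3 → E3, (∀ n, ContDiff ℝ ∞ (A n)) ∧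
      (∀ n, tsupport (A n) ⊆ Metric.closedBall 0 (R + 1)) ∧
      ∃ (ha : ∀ n, MemLp (A n) 2 volume) (hb : ∀ n, MemLp (classicalCurl (A n)) 2 volume),
        Tendsto (fun n => (ha n).toLp (A n)) atTop (𝓝 (h.memLp_left.toLp V)) ∧
        Tendsto (fun n => (hb n).toLp (classicalCurl (A n))) atTop
          (𝓝 (h.memLp_right.toLp W)) := by
  have hs := fun n => contDiff_mollify h.memLp_left n
  have ht := fun n => tsupport_mollify_subset hVR n
  have hc : ∀ n, HasCompactSupport (mollify n V) := fun n =>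
    (isCompact_closedBall (0 : E3) (R + 1)).of_isClosed_subset (isClosed_tsupport _) (ht n)
  have hcurl : ∀ n, classicalCurl (mollify n V) = mollify n W := fun n =>
    funext fun x => h.classicalCurl_convolution (shrinkingBump n).contDiff_normed
      (shrinkingBump n).hasCompactSupport_normed x
  refine ⟨fun n => mollify n V, hs, ht,
    fun n => (hs n).continuous.memLp_of_hasCompactSupport (hc n),
    fun n => (continuous_classicalCurl (hs n)).memLp_of_hasCompactSupport
      (hasCompactSupport_classicalCurl (hc n)), ?_, ?_⟩
  · exact (Lp.tendsto_Lp_iff_tendsto_eLpNorm'' _ _ _ _).2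
      (tendsto_eLpNorm_mollify_sub hVm h.memLp_left)
  · rw [Lp.tendsto_Lp_iff_tendsto_eLpNorm'']
    simp only [hcurl]
    exact tendsto_eLpNorm_mollify_sub hWm h.memLp_right

theorem inner_toLp_eq_integral {μ : Measure E3} {V W : E3 → E3} (hV : MemLp V 2 μ)
    (hW : MemLp W 2 μ) : inner ℝ (hV.toLp V) (hW.toLp W) = ∫ x, inner ℝ (V x) (W x) ∂μ := by
  rw [L2.inner_def]
  refine integral_congr_ae ?_
  filter_upwards [hV.coeFn_toLp, hW.coeFn_toLp] with x h1 h2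
  rw [h1, h2]

open Filter Topology in
/-- The curl is symmetric. -/
theorem IsCurlPair.integral_inner_comm {V W V' W' : E3 → E3} (h : IsCurlPair V W)
    (h' : IsCurlPair V' W') (hVm : StronglyMeasurable V') (hWm : StronglyMeasurable W') {R : ℝ}
    (hVR : ∀ x, V' x ≠ 0 → ‖x‖ ≤ R) :
    ∫ x, inner ℝ (W x) (V' x) = ∫ x, inner ℝ (V x) (W' x) := by
  -- Only the second pair needs smoothing: the first admits every smooth field as a test.
  obtain ⟨A, hA, -, ha, hb, hta, htb⟩ := h'.exists_smooth_approx hVm hWm hVR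
  rw [← inner_toLp_eq_integral h.memLp_right h'.memLp_left,
    ← inner_toLp_eq_integral h.memLp_left h'.memLp_right]
  refine tendsto_nhds_unique (tendsto_const_nhds.inner hta)
    (Tendsto.congr (fun n => ?_) (tendsto_const_nhds.inner htb))
  rw [inner_toLp_eq_integral, inner_toLp_eq_integral, h.integral_eq _ (hA n)]

open Filter Topology in
/-- **Arnold's inequality**: the helicity is controlled by the energy. -/
theorem IsCurlPair.abs_integral_inner_le {V W : E3 → E3} (h : IsCurlPair V W)
    (hVm : StronglyMeasurable V) (hWm : StronglyMeasurable W) {R : ℝ} (hR : 0 ≤ R)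
    (hVR : ∀ x, V x ≠ 0 → ‖x‖ ≤ R) :
    |∫ x, inner ℝ (V x) (W x)| ≤ 2 * (R + 1) * ∫ x, inner ℝ (W x) (W x) := by
  obtain ⟨A, hA, hsupp, ha, hb, hta, htb⟩ := h.exists_smooth_approx hVm hWm hVR
  rw [← inner_toLp_eq_integral h.memLp_left h.memLp_right,
    ← inner_toLp_eq_integral h.memLp_right h.memLp_right]
  refine le_of_tendsto_of_tendsto' (hta.inner htb).abs ((htb.inner htb).const_mul _) fun n => ?_
  rw [inner_toLp_eq_integral, inner_toLp_eq_integral]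
  simp only [real_inner_self_eq_norm_sq]
  exact abs_integral_inner_classicalCurl_le (hA n)
    ((isCompact_closedBall (0 : E3) (R + 1)).of_isClosed_subset (isClosed_tsupport _) (hsupp n))
    (by positivity) fun x hx => mem_closedBall_zero_iff.1 (hsupp n hx)

/-! ### Fields on a domain -/

theorem integral_inner_indicator_left {Ω : Set E3} (hΩ : MeasurableSet Ω) (f g : E3 → E3) :
    ∫ x, inner ℝ (Ω.indicator f x) (g x) = ∫ x in Ω, inner ℝ (f x) (g x) := by
  rw [← integral_indicator hΩ]
  congr 1
  ext1 x
  by_cases hx : x ∈ Ω <;> simp [hx]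

theorem inner_eq_integral_indicator {Ω : Set E3} (hΩ : MeasurableSet Ω) (v w : L2V Ω) :
    inner ℝ v w = ∫ x, inner ℝ (Ω.indicator v x) (Ω.indicator w x) := by
  rw [integral_inner_indicator_left hΩ, L2.inner_def]
  refine setIntegral_congr_fun hΩ fun x hx => ?_
  simp [hx]

/-- The homogeneous tangential boundary condition means that extension by zero preserves the
weak curl. -/
theorem HasCurl0.isCurlPair {Ω : Set E3} (hΩ : MeasurableSet Ω) {v w : L2V Ω}
    (h : HasCurl0 Ω v w) : IsCurlPair (Ω.indicator v) (Ω.indicator w) where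
  memLp_left := (memLp_indicator_iff_restrict hΩ).2 (Lp.memLp v)
  memLp_right := (memLp_indicator_iff_restrict hΩ).2 (Lp.memLp w)
  integral_eq ψ hψ := by
    rw [integral_inner_indicator_left hΩ, integral_inner_indicator_left hΩ]
    exact sub_eq_zero.1 (h.2 ψ hψ)

theorem norm_le_of_indicator_ne_zero {Ω : Set E3} {R : ℝ} (hR : Ω ⊆ Metric.closedBall 0 R)
    (f : E3 → E3) (x : E3) (hx : Ω.indicator f x ≠ 0) : ‖x‖ ≤ R :=
  mem_closedBall_zero_iff.1 (hR (mem_of_indicator_ne_zero hx))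

/-- Green's formula in `H₀(curl)`. -/
theorem HasCurl0.inner_comm {Ω : Set E3} (hΩ : MeasurableSet Ω) (hb : Bornology.IsBounded Ω)
    {v w v' w' : L2V Ω} (h : HasCurl0 Ω v w) (h' : HasCurl0 Ω v' w') :
    inner ℝ w v' = inner ℝ v w' := by
  obtain ⟨R, hR⟩ := hb.subset_closedBall 0
  rw [inner_eq_integral_indicator hΩ, inner_eq_integral_indicator hΩ]
  exact (h.isCurlPair hΩ).integral_inner_comm (h'.isCurlPair hΩ)
    ((Lp.stronglyMeasurable v').indicator hΩ) ((Lp.stronglyMeasurable w').indicator hΩ)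
    (norm_le_of_indicator_ne_zero hR v')

/-- Arnold's inequality in `H₀(curl)`. -/
theorem HasCurl0.abs_inner_le {Ω : Set E3} (hΩ : MeasurableSet Ω) {R : ℝ} (hR : 0 ≤ R)
    (hΩR : Ω ⊆ Metric.closedBall 0 R) {v w : L2V Ω} (h : HasCurl0 Ω v w) :
    |inner ℝ v w| ≤ 2 * (R + 1) * ‖w‖ ^ 2 := by
  rw [← real_inner_self_eq_norm_sq, inner_eq_integral_indicator hΩ, inner_eq_integral_indicator hΩ]
  exact (h.isCurlPair hΩ).abs_integral_inner_le ((Lp.stronglyMeasurable v).indicator hΩ)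
    ((Lp.stronglyMeasurable w).indicator hΩ) hR (norm_le_of_indicator_ne_zero hΩR v)

theorem Continuous.memLp_restrict_of_isBounded {Ω : Set E3} (hb : Bornology.IsBounded Ω)
    (hΩ : MeasurableSet Ω) {f : E3 → E3} (hf : Continuous f) :
    MemLp f 2 (volume.restrict Ω) := by
  have : IsFiniteMeasure (volume.restrict Ω) := ⟨by simpa using hb.measure_lt_top⟩
  obtain ⟨c, hc⟩ := hb.isCompact_closure.exists_bound_of_continuousOn hf.continuousOn
  refine MemLp.of_bound hf.aestronglyMeasurable c ?_
  filter_upwards [ae_restrict_mem hΩ] with x hx using hc x (subset_closure hx)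

theorem setIntegral_inner_eq_inner_toLp {Ω : Set E3} (v : L2V Ω) {f : E3 → E3}
    (hf : MemLp f 2 (volume.restrict Ω)) :
    ∫ x in Ω, inner ℝ (v x) (f x) = inner ℝ v (hf.toLp f) := by
  rw [L2.inner_def]
  refine integral_congr_ae ?_
  filter_upwards [hf.coeFn_toLp] with x hx
  rw [hx]

/-! ### Discrete curls and a linear choice of potentials. -/

/-- `HasCurl0` as a family of orthogonality relations in `L²`. -/
theorem hasCurl0_iff {Ω : Set E3} (hb : Bornology.IsBounded Ω) (hΩ : MeasurableSet Ω)
    {v w : L2V Ω} :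
    HasCurl0 Ω v w ↔ ∀ (ψ : E3 → E3) (hψ : ContDiff ℝ ∞ ψ),
      inner ℝ w ((hψ.continuous.memLp_restrict_of_isBounded hb hΩ).toLp ψ)
        = inner ℝ v (((continuous_classicalCurl hψ).memLp_restrict_of_isBounded hb hΩ).toLp _) := by
  simp only [← setIntegral_inner_eq_inner_toLp]
  exact ⟨fun h ψ hψ => sub_eq_zero.1 (h.2 ψ hψ),
    fun h => ⟨fun ψ hψ _ _ => h ψ hψ, fun ψ hψ => sub_eq_zero.2 (h ψ hψ)⟩⟩

/-- The graph of the curl on `V`. -/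
def curlGraph {Ω : Set E3} (hb : Bornology.IsBounded Ω) (hΩ : MeasurableSet Ω)
    (V : Submodule ℝ (L2V Ω)) : Submodule ℝ (L2V Ω × L2V Ω) where
  carrier := {p | p.1 ∈ V ∧ HasCurl0 Ω p.1 p.2}
  zero_mem' := ⟨V.zero_mem, (hasCurl0_iff hb hΩ).2 fun ψ hψ => by simp⟩
  add_mem' := fun {p q} hp hq => ⟨V.add_mem hp.1 hq.1, (hasCurl0_iff hb hΩ).2 fun ψ hψ => by
    simp only [Prod.fst_add, Prod.snd_add, inner_add_left,
      (hasCurl0_iff hb hΩ).1 hp.2 ψ hψ, (hasCurl0_iff hb hΩ).1 hq.2 ψ hψ]⟩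
  smul_mem' := fun c p hp => ⟨V.smul_mem c hp.1, (hasCurl0_iff hb hΩ).2 fun ψ hψ => by
    simp only [Prod.smul_fst, Prod.smul_snd, inner_smul_left, (hasCurl0_iff hb hΩ).1 hp.2 ψ hψ]⟩

/-- The curls of the fields in `V`. -/
def curlImage {Ω : Set E3} (hb : Bornology.IsBounded Ω) (hΩ : MeasurableSet Ω)
    (V : Submodule ℝ (L2V Ω)) : Submodule ℝ (L2V Ω) :=
  LinearMap.range ((LinearMap.snd ℝ (L2V Ω) (L2V Ω)).comp (curlGraph hb hΩ V).subtype)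

theorem mem_curlImage {Ω : Set E3} {hb : Bornology.IsBounded Ω} {hΩ : MeasurableSet Ω}
    {V : Submodule ℝ (L2V Ω)} {w : L2V Ω} :
    w ∈ curlImage hb hΩ V ↔ ∃ v ∈ V, HasCurl0 Ω v w := by
  constructor
  · rintro ⟨⟨p, hp⟩, rfl⟩
    exact ⟨p.1, hp⟩
  · rintro ⟨v, hv, h⟩
    exact ⟨⟨(v, w), hv, h⟩, rfl⟩

/-- A bounded linear choice of potentials. -/
theorem exists_potential {Ω : Set E3} (hb : Bornology.IsBounded Ω) (hΩ : MeasurableSet Ω)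
    (V : Submodule ℝ (L2V Ω)) [FiniteDimensional ℝ (curlImage hb hΩ V)] :
    ∃ S : L2V Ω →L[ℝ] L2V Ω, ∀ w ∈ curlImage hb hΩ V, S w ∈ V ∧ HasCurl0 Ω (S w) w := by
  have : Module.Free ℝ (LinearMap.range
      ((LinearMap.snd ℝ (L2V Ω) (L2V Ω)).comp (curlGraph hb hΩ V).subtype)) :=
    Module.Free.of_divisionRing ℝ _
  have : Module.Projective ℝ (LinearMap.range
      ((LinearMap.snd ℝ (L2V Ω) (L2V Ω)).comp (curlGraph hb hΩ V).subtype)) :=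
    Module.Projective.of_free
  -- A linear section of the projection from the graph onto the curls; finite dimension of the
  -- target makes it continuous, and the orthogonal projection extends it to all of L².
  obtain ⟨s, hs⟩ := LinearMap.exists_rightInverse_of_surjective
    ((LinearMap.snd ℝ (L2V Ω) (L2V Ω)).comp (curlGraph hb hΩ V).subtype).rangeRestrict
    (LinearMap.range_rangeRestrict _)
  let s' : curlImage hb hΩ V →ₗ[ℝ] L2V Ω :=
    ((LinearMap.fst ℝ (L2V Ω) (L2V Ω)).comp (curlGraph hb hΩ V).subtype).comp s
  refine ⟨(LinearMap.toContinuousLinearMap s').comp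
    (curlImage hb hΩ V).orthogonalProjectionOnto, fun w hw => ?_⟩
  have e : (curlImage hb hΩ V).orthogonalProjectionOnto w = ⟨w, hw⟩ :=
    Submodule.orthogonalProjectionOnto_mem_subspace_eq_self (⟨w, hw⟩ : curlImage hb hΩ V)
  have hp := (s ⟨w, hw⟩).2
  have hsnd : (s ⟨w, hw⟩).1.2 = w := congrArg Subtype.val (LinearMap.congr_fun hs ⟨w, hw⟩)
  have hS : ((LinearMap.toContinuousLinearMap s').comp
      (curlImage hb hΩ V).orthogonalProjectionOnto) w = (s ⟨w, hw⟩).1.1 := by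
    rw [ContinuousLinearMap.comp_apply, e]
    rfl
  rw [hS]
  refine ⟨hp.1, ?_⟩
  have := hp.2
  rwa [hsnd] at this

/-! ### Functions on a half-line -/

theorem antitoneOn_Ici_of_hasDerivWithinAt_nonpos {f f' : ℝ → ℝ}
    (hf : ∀ t, 0 ≤ t → HasDerivWithinAt f (f' t) (Ici 0) t) (hf' : ∀ t, 0 ≤ t → f' t ≤ 0) :
    AntitoneOn f (Ici 0) := by
  have hd : ∀ t ∈ interior (Ici (0 : ℝ)), HasDerivAt f (f' t) t := by
    intro t ht
    rw [interior_Ici] at ht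
    exact (hf t (le_of_lt ht)).hasDerivAt (Ici_mem_nhds ht)
  refine antitoneOn_of_deriv_nonpos (convex_Ici 0) (fun t ht => (hf t ht).continuousWithinAt)
    (fun t ht => (hd t ht).differentiableAt.differentiableWithinAt) fun t ht => ?_
  rw [(hd t ht).deriv]
  exact hf' t (interior_subset ht)

theorem eq_of_hasDerivWithinAt_Ici_zero {f : ℝ → ℝ}
    (hf : ∀ t, 0 ≤ t → HasDerivWithinAt f 0 (Ici 0) t) {t : ℝ} (ht : 0 ≤ t) : f t = f 0 := by
  have h1 := antitoneOn_Ici_of_hasDerivWithinAt_nonpos hf (fun _ _ => le_rfl) self_mem_Ici ht ht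
  have h2 := antitoneOn_Ici_of_hasDerivWithinAt_nonpos
    (f := fun t => -f t) (f' := fun _ => 0) (fun t ht => (hf t ht).neg.congr_deriv neg_zero)
    (fun _ _ => le_rfl) self_mem_Ici ht ht
  simp only [neg_le_neg_iff] at h2
  exact le_antisymm h1 h2

/-! ### The scheme -/

namespace IsSchemeSolution

variable {Ω : Set E3} {X : DiscreteComplex Ω} {τ : ℝ} {B₀ : L2V Ω} {B E j H : ℝ → L2V Ω}

theorem hasDerivWithinAt (h : IsSchemeSolution X τ B₀ B E j H) {t : ℝ} (ht : 0 ≤ t) :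
    HasDerivWithinAt B (derivWithin B (Ici 0) t) (Ici 0) t :=
  (h.B_contDiff.differentiableOn (by simp) t ht).hasDerivWithinAt

/-- The derivative lies in the closure of the span of the values of `B`, and a finite-dimensional
subspace is closed. -/
theorem derivWithin_mem (h : IsSchemeSolution X τ B₀ B E j H) (t : ℝ) :
    derivWithin B (Ici 0) t ∈ X.VDiv := by
  have := X.finite_VDiv
  have h1 := range_derivWithin_subset_closure_span_image (𝕜 := ℝ) B (s := Ici 0) (t := Ici 0)
    (by simp) (mem_range_self t)
  refine (X.VDiv.closed_of_finiteDimensional.closure_subset_iff.2 ?_) h1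
  refine Submodule.span_le.2 ?_
  rintro _ ⟨s, hs, rfl⟩
  exact h.B_mem s hs

/-- Faraday's law holds strongly. -/
theorem hasCurl0_neg_derivWithin (h : IsSchemeSolution X τ B₀ B E j H) (hΩ : IsOpen Ω)
    {t : ℝ} (ht : 0 ≤ t) : HasCurl0 Ω (E t) (-derivWithin B (Ici 0) t) := by
  obtain ⟨c, hc, hadv⟩ := h.advection t ht
  obtain ⟨c', hc'm, hc'⟩ := X.curl_mem _ (h.E_mem t ht)
  rw [← hc.unique hΩ hc'] at hc'm
  -- B' + curl E is itself an admissible test field, hence it vanishes.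
  have hz := hadv _ (X.VDiv.add_mem (h.derivWithin_mem t) hc'm)
  rw [← inner_add_left, inner_self_eq_zero] at hz
  rwa [neg_eq_of_add_eq_zero_right hz]

/-- The magnetic field is orthogonal to the electric field. -/
theorem inner_B_E (h : IsSchemeSolution X τ B₀ B E j H) {t : ℝ} (ht : 0 ≤ t) :
    inner ℝ (B t) (E t) = 0 := by
  -- Test with F = H: the coupling term vanishes pointwise. The equation for `H` then replaces `H`
  -- by `B` against `E`.
  have h1 := (h.electric t ht _ (h.H_mem t ht)).2
  simp only [inner_cross_self_right, integral_zero, mul_zero, add_zero] at h1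
  rw [← h.auxiliary t ht _ (h.E_mem t ht), real_inner_comm, h1]

/-- The Lorentz force does not produce energy. -/
theorem inner_j_E_nonneg (h : IsSchemeSolution X τ B₀ B E j H) (hτ : 0 ≤ τ) {t : ℝ}
    (ht : 0 ≤ t) : 0 ≤ inner ℝ (j t) (E t) := by
  -- Test with F = j, which gives (E, j) = τ ∫ |j × H|².
  have h1 := (h.electric t ht _ (h.j_mem t ht)).2
  simp only [inner_cross_cross_left, integral_neg] at h1
  have h2 : 0 ≤ ∫ x in Ω, ‖cross (j t x) (H t x)‖ ^ 2 := integral_nonneg fun x => by positivity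
  rw [real_inner_comm]
  nlinarith

/-- The current equation with K = E gives d/dt ‖B‖² = 2(B, B') = -2(B, curl E) = -2(j, E) ≤ 0. -/
theorem discreteEnergy_antitoneOn (h : IsSchemeSolution X τ B₀ B E j H) (hΩ : IsOpen Ω)
    (hτ : 0 ≤ τ) : AntitoneOn (fun t => discreteEnergy (B t)) (Ici 0) := by
  refine antitoneOn_Ici_of_hasDerivWithinAt_nonpos
    (fun t ht => (h.hasDerivWithinAt ht).norm_sq) fun t ht => ?_
  have h1 := h.current t ht _ (h.E_mem t ht) _ (h.hasCurl0_neg_derivWithin hΩ ht)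
  have h2 := h.inner_j_E_nonneg hτ ht
  rw [inner_neg_right] at h1
  linarith

/-- The magnetic field keeps a discrete potential. -/
theorem mem_curlImage (h : IsSchemeSolution X τ B₀ B E j H) (hΩ : IsOpen Ω)
    (hb : Bornology.IsBounded Ω) [FiniteDimensional ℝ (curlImage hb hΩ.measurableSet X.VCurl)]
    (hB₀ : B₀ ∈ curlImage hb hΩ.measurableSet X.VCurl) {t : ℝ} (ht : 0 ≤ t) :
    B t ∈ curlImage hb hΩ.measurableSet X.VCurl := by
  -- For `z` orthogonal to all discrete curls, (z, B) has derivative -(z, curl E) = 0 and starts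
  -- from (z, B₀) = 0.
  rw [← Submodule.orthogonal_orthogonal (curlImage hb hΩ.measurableSet X.VCurl),
    Submodule.mem_orthogonal]
  intro z hz
  rw [Submodule.mem_orthogonal'] at hz
  have hconst := eq_of_hasDerivWithinAt_Ici_zero (f := fun t => inner ℝ z (B t))
    (fun t ht => ((hasDerivWithinAt_const t (Ici 0) z).inner ℝ (h.hasDerivWithinAt ht)).congr_deriv
      (by
        have hm : -derivWithin B (Ici 0) t ∈ curlImage hb hΩ.measurableSet X.VCurl :=
          _root_.mem_curlImage.2 ⟨_, h.E_mem t ht, h.hasCurl0_neg_derivWithin hΩ ht⟩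
        have := hz _ hm
        rw [inner_neg_right, neg_eq_zero] at this
        simp [this])) ht
  exact hconst.trans (by rw [h.initial]; exact hz _ hB₀)

end IsSchemeSolution

end

/-! ### The energy bounds. -/

/-- Boundedness of the discrete energy: with a constant `C > 0` depending only on the domain, the
discrete helicity `h` of any solution is well defined and constant in time, and the discrete energy
stays in the interval `[C |h|, energy at time 0]`. -/
theorem corollary3p3 (Ω : Set E3) (hΩ : IsBoundedLipschitzDomain Ω) (hc : ContractibleSpace Ω) :
    ∃ C : ℝ, 0 < C ∧
      ∀ (X : DiscreteComplex Ω) (τ : ℝ), 0 < τ →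
      ∀ B₀ ∈ X.VDiv, HasDiv0 Ω B₀ 0 →
      ∀ B E j H : ℝ → L2V Ω, IsSchemeSolution X τ B₀ B E j H →
        ∃ h : ℝ, ∀ t : ℝ, 0 ≤ t →
          IsDiscreteHelicity X (B t) h ∧
          C * |h| ≤ discreteEnergy (B t) ∧
          discreteEnergy (B t) ≤ discreteEnergy (B 0) := by
  have ho := hΩ.isOpen
  have hm := ho.measurableSet
  have hb := hΩ.isBounded
  obtain ⟨R, hR, hΩR⟩ := hb.subset_closedBall_lt 0 0
  -- The reciprocal of the constant in Arnold's inequality, for a ball of radius `R` around the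
  -- origin containing the domain.
  refine ⟨(2 * (R + 1))⁻¹, by positivity, fun X τ hτ B₀ hB₀ hdiv B E j H hsol => ?_⟩
  have : FiniteDimensional ℝ X.VDiv := X.finite_VDiv
  have hle : curlImage hb hm X.VCurl ≤ X.VDiv := by
    intro w hw
    obtain ⟨v, hv, hvw⟩ := mem_curlImage.1 hw
    obtain ⟨w', hw', hvw'⟩ := X.curl_mem v hv
    rwa [hvw.unique ho hvw']
  have : FiniteDimensional ℝ (curlImage hb hm X.VCurl) := Submodule.finiteDimensional_of_le hle
  obtain ⟨S, hS⟩ := exists_potential hb hm X.VCurl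
  have hBZ : ∀ t, 0 ≤ t → B t ∈ curlImage hb hm X.VCurl := fun t ht =>
    hsol.mem_curlImage ho hb (mem_curlImage.2 (X.exact_VDiv _ hB₀ hdiv)) ht
  have hhel : ∀ t, 0 ≤ t → inner ℝ (S (B t)) (B t) = inner ℝ (S (B 0)) (B 0) := by
    intro t ht
    refine eq_of_hasDerivWithinAt_Ici_zero (f := fun t => inner ℝ (S (B t)) (B t))
      (fun t ht => ?_) ht
    have hE := hsol.hasCurl0_neg_derivWithin ho ht
    have hd := hsol.hasDerivWithinAt ht
    have hB'Z : derivWithin B (Ici 0) t ∈ curlImage hb hm X.VCurl :=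
      neg_mem_iff.1 (mem_curlImage.2 ⟨_, hsol.E_mem t ht, hE⟩)
    -- The derivative is (SB, B') + (SB', B). By symmetry of the curl the two terms agree, and (SB,
    -- B') = -(SB, curl E) = -(B, E) = 0.
    refine ((S.hasFDerivAt.comp_hasDerivWithinAt t hd).inner ℝ hd).congr_deriv ?_
    have e1 := (hS _ hB'Z).2.inner_comm hm hb (hS _ (hBZ t ht)).2
    have e2 := (hS _ (hBZ t ht)).2.inner_comm hm hb hE
    rw [hsol.inner_B_E ht, inner_neg_right, eq_comm, neg_eq_zero] at e2
    rw [real_inner_comm] at e2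
    rw [← e1, real_inner_comm, Function.comp_apply, e2, add_zero]
  refine ⟨inner ℝ (S (B 0)) (B 0), fun t ht => ⟨⟨⟨S (B t), hS _ (hBZ t ht)⟩, fun A _ hAB => ?_⟩,
    ?_, hsol.discreteEnergy_antitoneOn ho hτ.le self_mem_Ici ht ht⟩⟩
  -- Independence of the potential: (A, B) = (A, curl SB) = (curl A, SB) = (B, SB).
  · rw [← hhel t ht, ← hAB.inner_comm hm hb (hS _ (hBZ t ht)).2, real_inner_comm]
  · rw [← hhel t ht, inv_mul_le_iff₀ (by positivity)]
    exact (hS _ (hBZ t ht)).2.abs_inner_le hm hR.le hΩR
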